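/- Let $n\ge 1$ sensors form an undirected weighted graph $\mathscr G$ with symmetric stochastic weight matrix $\mathcal A=(a_{ij})$, where for $i\ne j$ one has $a_{ij}>0$ if $(i,j)$ is an edge and $a_{ij}=0$ otherwise, and $a_{ii}\ge 0$; let $N^i$ be the set of neighbours of $i$ together with $i$ itself. Let $\theta\in\mathbb R^m$, let $\varphi^i_k$ ($k\ge 0$) be random vectors in $\mathbb R^m$ and $\varepsilon^i_k$ ($k\ge1$) real random variables on a probability space, and let $$y^i_{k+1}=\theta^T\varphi^i_k+\varepsilon^i_{k+1},\qquad k\ge 0,\ 1\le i\le n .$$ Let $\mu,\nu\in(0,1)$, let $Q$ be an integer with $Q\ge D(\mathscr G)$ (the diameter of $\mathscr G$), and put $$r^i_k=1+\sum_{j=1}^k\|\varphi^i_j\|^2,\qquad x^i_k(0)=\frac{\|\varphi^i_k\|^2}{r^i_k},\qquad x^i_k(q+1)=\sum_{j\in N^i}a_{ij}x^j_k(q).$$ Given an initial value $\hat\Theta_0=(\hat\theta^1_0,\dots,\hat\theta^n_0)$, the distributed stochastic gradient (SG) estimate $\hat\Theta_k=(\hat\theta^1_k,\dots,\hat\theta^n_k)$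 is defined by $$z^i_k=x^i_k(Q)\sum_{l\in N^i}a_{li}(\hat\theta^i_k-\hat\theta^l_k),\qquad \hat\theta^i_{k+1}=\hat\theta^i_k+\mu\frac{\varphi^i_k}{r^i_k}\bigl(y^i_{k+1}-(\varphi^i_k)^T\hat\theta^i_k\bigr)-\mu\nu\sum_{j\in N^i}a_{ij}(z^i_k-z^j_k).$$ Let $\Theta=(\theta,\dots,\theta)$, $\Phi_k=\mathrm{diag}(\varphi^1_k,\dots,\varphi^n_k)\in\mathbb R^{mn\times n}$, $R_k=\mathrm{diag}(r^1_k,\dots,r^n_k)$, $X_k=\mathrm{diag}(x^1_k(Q),\dots,x^n_k(Q))$, $\mathscr L=(I_n-\mathcal A)\otimes I_m$, $$G_k=\Phi_kR_k^{-1}\Phi_k^T+\nu\,\mathscr L(X_k\otimes I_m)\mathscr L,$$ $\Psi(0,0)=I_{mn}$, $\Psi(k+1,0)=(I_{mn}-\mu G_k)\Psi(k,0)$; let $\Xi_k=(\varepsilon^1_k,\dots,\varepsilon^n_k)$ and let $\mathscr F_k$ be the $\sigma$-algebra generated by $\varphi^i_j$ ($0\le j\le k$) and $\varepsilon^i_j$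 ($1\le j\le k$), $1\le i\le n$. Norms are Euclidean (spectral for matrices). Assume that 1. $\mathscr G$ is connected; 2. $(\Xi_k)_{k\ge1}$ is a martingale difference sequence: each $\Xi_{k+1}$ is integrable and $E(\Xi_{k+1}\mid\mathscr F_k)=0$ for $k\ge 0$; and almost surely there are $c_0>0$ and $\epsilon\in[0,1)$ (which may depend on $\omega$) such that $E(\|\Xi_{k+1}\|^2\mid\mathscr F_k)\le c_0\|R_k\|^{\epsilon}$ for all $k\ge0$; 3. the condition number of $R_k$ is bounded: almost surely there is $\gamma>0$ (which may depend on $\omega$) with $\max_i r^i_k/\min_i r^i_k\le\gamma$ for all $k\ge 0$; 4. $\mu(1+4\nu)<1$; 5. $I_{mn}-\mu G_0$ is almost surely nonsingular (given 4, this holds for instance if $\|\varphi^i_0\|\le 1$ for all $i$). Then the following are equivalent: (a) for every initial value $\hat\Theta_0\in\mathbb R^{mn}$, $\hat\Theta_k\to\Theta$ almost surely as $k\to\infty$; (b) $\Psi(k,0)\to0$ almost surely as $k\to\infty$. -/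

import Mathlib

open MeasureTheory Filter Topology
open scoped Matrix Kronecker Matrix.Norms.L2Operator

namespace DistSG

/-- An undirected weighted graph on the sensors `0, …, n - 1` whose weighted adjacency matrix is
symmetric and stochastic. Edges between distinct sensors are recorded by `graph`; a sensor always
counts as its own neighbour, and its self-weight `weight i i` is only required to be nonnegative. -/
structure SensorNetwork (n : ℕ) where
  graph : SimpleGraph (Fin n)
  weight : Matrix (Fin n) (Fin n) ℝ
  weight_pos : ∀ i j, graph.Adj i j → 0 < weight i j
  weight_eq_zero : ∀ i j, i ≠ j → ¬ graph.Adj i j → weight i j = 0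
  weight_self_nonneg : ∀ i, 0 ≤ weight i i
  weight_symm : weight.IsSymm
  weight_row_sum : ∀ i, ∑ j, weight i j = 1

/-- A realization of the regressors: `φ k i` is the regression vector of sensor `i` at time `k`. -/
abbrev RegressorPath (n m : ℕ) : Type := ℕ → Fin n → EuclideanSpace ℝ (Fin m)

noncomputable section

variable {n m : ℕ}

open Classical in
/-- The neighbour set `N^i`, which contains `i` itself. -/
def SensorNetwork.nbhd (N : SensorNetwork n) (i : Fin n) : Finset (Fin n) :=
  {j | N.graph.Adj i j ∨ j = i}

/-- `r^i_k = 1 + ∑_{j=1}^k ‖φ^i_j‖²`. -/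
def gain (φ : RegressorPath n m) (k : ℕ) (i : Fin n) : ℝ :=
  1 + ∑ j ∈ Finset.Icc 1 k, ‖φ j i‖ ^ 2

/-- The diffused scalars `x^i_k(q)`. -/
def diffusion (N : SensorNetwork n) (φ : RegressorPath n m) (k : ℕ) : ℕ → Fin n → ℝ
  | 0 => fun i => ‖φ k i‖ ^ 2 / gain φ k i
  | q + 1 => fun i => ∑ j ∈ N.nbhd i, N.weight i j * diffusion N φ k q j

/-- `z^i_k = x^i_k(Q) ∑_{l ∈ N^i} a_{li} (θ̂^i - θ̂^l)` at the current estimates `T`. -/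
def localDisagreement (N : SensorNetwork n) (φ : RegressorPath n m) (Q k : ℕ)
    (T : Fin n → EuclideanSpace ℝ (Fin m)) (i : Fin n) : EuclideanSpace ℝ (Fin m) :=
  diffusion N φ k Q i • ∑ l ∈ N.nbhd i, N.weight l i • (T i - T l)

/-- The estimates `Θ̂_k = (θ̂^1_k, …, θ̂^n_k)` of the distributed stochastic gradient algorithm,
driven by the regressors `φ` and the observations `y k i = y^i_k`, started at `T₀`. -/
def estimate (N : SensorNetwork n) (μ ν : ℝ) (Q : ℕ) (φ : RegressorPath n m)
    (y : ℕ → Fin n → ℝ) (T₀ : Fin n → EuclideanSpace ℝ (Fin m)) :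
    ℕ → Fin n → EuclideanSpace ℝ (Fin m)
  | 0 => T₀
  | k + 1 => fun i =>
      let T := estimate N μ ν Q φ y T₀ k
      T i + (μ / gain φ k i * (y (k + 1) i - inner ℝ (φ k i) (T i))) • φ k i
        - (μ * ν) • ∑ j ∈ N.nbhd i, N.weight i j •
            (localDisagreement N φ Q k T i - localDisagreement N φ Q k T j)

/-- `Φ_k = diag(φ^1_k, …, φ^n_k)`, of size `mn × n`. -/
def regMatrix (φ : RegressorPath n m) (k : ℕ) : Matrix (Fin n × Fin m) (Fin n) ℝ :=
  Matrix.of fun p j => if p.1 = j then φ k j p.2 else 0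

/-- `R_k = diag(r^1_k, …, r^n_k)`. -/
def gainMatrix (φ : RegressorPath n m) (k : ℕ) : Matrix (Fin n) (Fin n) ℝ :=
  Matrix.diagonal (gain φ k)

/-- `𝓛 = L ⊗ I_m` with the graph Laplacian `L = I - 𝒜`. -/
def bigLaplacian (N : SensorNetwork n) (m : ℕ) : Matrix (Fin n × Fin m) (Fin n × Fin m) ℝ :=
  (1 - N.weight) ⊗ₖ (1 : Matrix (Fin m) (Fin m) ℝ)

/-- `G_k = Φ_k R_k⁻¹ Φ_kᵀ + ν 𝓛 (X_k(Q) ⊗ I_m) 𝓛`. -/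
def gMatrix (N : SensorNetwork n) (ν : ℝ) (Q : ℕ) (φ : RegressorPath n m) (k : ℕ) :
    Matrix (Fin n × Fin m) (Fin n × Fin m) ℝ :=
  regMatrix φ k * (gainMatrix φ k)⁻¹ * (regMatrix φ k)ᵀ +
    ν • (bigLaplacian N m *
      (Matrix.diagonal (diffusion N φ k Q) ⊗ₖ (1 : Matrix (Fin m) (Fin m) ℝ)) *
      bigLaplacian N m)

/-- The transition matrix `Ψ(k, j)`: `Ψ(j, j) = I` and `Ψ(k+1, j) = (I - μ G_k) Ψ(k, j)` for
`k ≥ j` (and `Ψ(k, j) = I` for `k < j`). -/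
def transition (N : SensorNetwork n) (μ ν : ℝ) (Q : ℕ) (φ : RegressorPath n m) (j : ℕ) :
    ℕ → Matrix (Fin n × Fin m) (Fin n × Fin m) ℝ
  | 0 => 1
  | k + 1 => if j ≤ k then (1 - μ • gMatrix N ν Q φ k) * transition N μ ν Q φ j k else 1

/-- The noise vector `Ξ_k = (ε^1_k, …, ε^n_k)` with its Euclidean norm. -/
def noiseVec {Ω : Type*} (ε : ℕ → Fin n → Ω → ℝ) (k : ℕ) (ω : Ω) : EuclideanSpace ℝ (Fin n) :=
  WithLp.toLp 2 fun i => ε k i ω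

/-- `𝓕_k`, generated by all `φ^i_j` with `0 ≤ j ≤ k` and all `ε^i_j` with `1 ≤ j ≤ k`. -/
abbrev history {Ω : Type*} (φ : ℕ → Fin n → Ω → EuclideanSpace ℝ (Fin m))
    (ε : ℕ → Fin n → Ω → ℝ) (k : ℕ) : MeasurableSpace Ω :=
  (⨆ j ∈ Set.Iic k, ⨆ i, MeasurableSpace.comap (φ j i) inferInstance) ⊔
    ⨆ j ∈ Set.Icc 1 k, ⨆ i, MeasurableSpace.comap (ε j i) inferInstance

end

end DistSG

/-! The estimation error obeys `e (k+1) = (1 - H k) e k + w k` with `H k = μ G_k` and `w k` the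
noise scaled by `μ φ / r`. Two runs on the same data differ by a homogeneous solution, so
convergence from zero and from each basis vector forces `Ψ → 0`.

For the converse, `Ψ(k,0) → 0` alone gives no rate, so the noise is handled path by path. Take `δ >
0` with `2δ < 1 - e`, where `e` is now the noise growth exponent. The series `∑ φ r^(δ-1) ε`
converges almost surely (`ae_exists_tendsto_sum_mul_of_tsum_condLExp_ne_top`), because its
conditional variance is dominated by a multiple of `∑ ‖φ‖² / r^(1+s)` with `s > 0`, a series
comparable to a telescoping one. Abel summation (`exists_tail_of_antitone_mul`) makes the tails `S k
= ∑_{j ≥ k} w j` of order `r^(-δ)`.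

Then `f = e + S`, with `e` the error again, satisfies `f (k+1) = (1 - H k) f k + H k S k`, and
operator convexity bounds the growth of `|f|²` in one step by `S · H S`. These energies are
summable: `H k` is bounded by a multiple of `∑ ‖φ‖² / r`, and the condition number bound makes the
gains of different sensors comparable. In `tendsto_zero_of_recursion`, `f` splits at a late time `J`
into the homogeneous solution through `f J`, which vanishes since `Ψ → 0` and `Ψ J` is invertible,
and a remainder started at zero whose energy is at most a tail of the sum. -/

namespace DistSG

/-! ### Local convergence of martingale transforms -/

section MartingaleConvergence

open scoped ENNReal

variable {Ω : Type*} {m0 : MeasurableSpace Ω} {P : Measure Ω}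

/-- The measures with densities `X` and `P⁻[X | m']` agree on `m'`, and integrating `g` only sees
that restriction. -/
theorem lintegral_mul_condLExp [IsFiniteMeasure P] {m' : MeasurableSpace Ω} (hm : m' ≤ m0)
    {g X : Ω → ℝ≥0∞} (hg : Measurable[m'] g) (hX : Measurable[m0] X) :
    ∫⁻ ω, g ω * (P⁻[X | m']) ω ∂P = ∫⁻ ω, g ω * X ω ∂P := by
  have key : (P.withDensity (P⁻[X | m'])).trim hm = (P.withDensity X).trim hm := by
    refine @Measure.ext _ m' _ _ fun s hs => ?_
    rw [trim_measurableSet_eq hm hs, trim_measurableSet_eq hm hs, withDensity_apply _ (hm s hs),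
      withDensity_apply _ (hm s hs), setLIntegral_condLExp hm P X hs]
  have h1 := lintegral_withDensity_eq_lintegral_mul P (measurable_condLExp' m' P X)
    (hg.mono hm le_rfl)
  have h2 := lintegral_withDensity_eq_lintegral_mul P hX (hg.mono hm le_rfl)
  rw [← lintegral_trim hm hg, key, lintegral_trim hm hg, h2] at h1
  simpa [mul_comm] using h1.symm

/-- A martingale transform with summable second moments converges almost surely. -/
theorem ae_exists_tendsto_sum_mul_of_tsum_lintegral_ne_top [IsProbabilityMeasure P]
    (ℱ : Filtration ℕ m0) {ξ c : ℕ → Ω → ℝ} (hξ : ∀ k, Measurable[ℱ (k + 1)] (ξ k))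
    (hint : ∀ k, Integrable (ξ k) P) (hmds : ∀ k, P[ξ k | ℱ k] =ᵐ[P] 0)
    (hc : ∀ k, Measurable[ℱ k] (c k))
    (hsum : ∑' k, ∫⁻ ω, ‖c k ω‖ₑ ^ 2 * ‖ξ k ω‖ₑ ^ 2 ∂P ≠ ∞) :
    ∀ᵐ ω ∂P, ∃ l, Tendsto (fun K => ∑ k ∈ Finset.range K, c k ω * ξ k ω) atTop (𝓝 l) := by
  have hξ0 : ∀ k, Measurable (ξ k) := fun k => (hξ k).mono (ℱ.le _) le_rfl
  have hc0 : ∀ k, Measurable (c k) := fun k => (hc k).mono (ℱ.le _) le_rfl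
  have hd2 : ∀ k, MemLp (c k * ξ k) 2 P := by
    intro k
    refine ⟨((hc0 k).mul (hξ0 k)).aestronglyMeasurable, ?_⟩
    rw [eLpNorm_lt_top_iff_lintegral_rpow_enorm_lt_top (by norm_num) (by norm_num)]
    refine lt_of_le_of_lt (le_of_eq ?_) (lt_of_le_of_lt (ENNReal.le_tsum k) hsum.lt_top)
    refine lintegral_congr fun ω => ?_
    simp [enorm_mul, mul_pow]
  have hdint : ∀ k, Integrable (c k * ξ k) P := fun k => (hd2 k).integrable one_le_two
  have hd0 : ∀ k, P[c k * ξ k | ℱ k] =ᵐ[P] 0 := by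
    intro k
    filter_upwards [condExp_mul_of_stronglyMeasurable_left (hc k).stronglyMeasurable (hdint k)
      (hint k), hmds k] with ω h1 h2
    simp [h1, h2]
  set M : ℕ → Ω → ℝ := fun K => ∑ k ∈ Finset.range K, c k * ξ k with hM
  have hMs : ∀ K, M (K + 1) = M K + c K * ξ K := fun K => by simp [hM, Finset.sum_range_succ]
  have hMmeas : ∀ K, Measurable[ℱ K] (M K) := by
    intro K
    rw [show M K = fun ω => ∑ k ∈ Finset.range K, (c k * ξ k) ω by ext ω; simp [hM]]
    refine Finset.measurable_fun_sum _ fun k hk => ?_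
    have hk' := Finset.mem_range.1 hk
    exact ((hc k).mono (ℱ.mono hk'.le) le_rfl).mul ((hξ k).mono (ℱ.mono hk') le_rfl)
  have hM2 : ∀ K, MemLp (M K) 2 P := fun K => memLp_finsetSum' _ fun k _ => hd2 k
  have hmart : Martingale M ℱ P := by
    refine martingale_of_condExp_sub_eq_zero_nat (fun K => (hMmeas K).stronglyMeasurable)
      (fun K => (hM2 K).integrable one_le_two) fun K => ?_
    rw [hMs, add_sub_cancel_left]
    exact hd0 K
  have hsq : ∀ k, ∫ ω, (c k ω * ξ k ω) ^ 2 ∂P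
      = (∫⁻ ω, ‖c k ω‖ₑ ^ 2 * ‖ξ k ω‖ₑ ^ 2 ∂P).toReal := by
    intro k
    rw [integral_eq_lintegral_of_nonneg_ae (f := fun ω => (c k ω * ξ k ω) ^ 2) (ae_of_all _ fun ω => sq_nonneg _)
      (hd2 k).integrable_sq.aestronglyMeasurable]
    congr 1
    refine lintegral_congr fun ω => ?_
    rw [← mul_pow, ← enorm_mul, ← enorm_pow, Real.enorm_of_nonneg (sq_nonneg _)]
  -- Orthogonality of increments reduces the second moment of `M K` to a sum of variances.
  have horth : ∀ K, ∫ ω, M K ω * (c K ω * ξ K ω) ∂P = 0 := by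
    intro K
    have hi : Integrable (M K * (c K * ξ K)) P := (hM2 K).integrable_mul (hd2 K)
    have h1 := condExp_mul_of_stronglyMeasurable_left (hMmeas K).stronglyMeasurable hi (hdint K)
    have h2 : P[M K * (c K * ξ K) | ℱ K] =ᵐ[P] 0 := by
      filter_upwards [h1, hd0 K] with ω h1 h2
      simp [h1, h2]
    have h3 := integral_condExp (ℱ.le K) (f := M K * (c K * ξ K)) (μ := P)
    rw [integral_congr_ae h2] at h3
    simpa using h3.symm
  have hvar : ∀ K, ∫ ω, M K ω ^ 2 ∂P = ∑ k ∈ Finset.range K, ∫ ω, (c k ω * ξ k ω) ^ 2 ∂P := by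
    intro K
    induction K with
    | zero => simp [hM]
    | succ K ih =>
      rw [Finset.sum_range_succ, ← ih]
      have e : ∀ ω, M (K + 1) ω ^ 2
          = (M K ω ^ 2 + (c K ω * ξ K ω) ^ 2) + 2 * (M K ω * (c K ω * ξ K ω)) := by
        intro ω
        rw [hMs]
        simp only [Pi.add_apply, Pi.mul_apply]
        ring
      simp_rw [e]
      have i1 : Integrable (fun ω => M K ω ^ 2) P := (hM2 K).integrable_sq
      have i2 : Integrable (fun ω => (c K ω * ξ K ω) ^ 2) P := (hd2 K).integrable_sq
      have i3 : Integrable (fun ω => 2 * (M K ω * (c K ω * ξ K ω))) P :=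
        ((hM2 K).integrable_mul (hd2 K)).const_mul 2
      rw [integral_add (f := fun ω => M K ω ^ 2 + (c K ω * ξ K ω) ^ 2) (i1.add i2) i3,
        integral_add i1 i2, integral_const_mul, horth]
      ring
  set B := ∑' k, ∫⁻ ω, ‖c k ω‖ₑ ^ 2 * ‖ξ k ω‖ₑ ^ 2 ∂P with hB
  have hvarB : ∀ K, ∫ ω, M K ω ^ 2 ∂P ≤ B.toReal := by
    intro K
    rw [hvar]
    simp_rw [hsq]
    rw [← ENNReal.toReal_sum fun k _ =>
      (lt_of_le_of_lt (ENNReal.le_tsum k) hsum.lt_top).ne]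
    exact ENNReal.toReal_mono hsum (ENNReal.sum_le_tsum _)
  have hbdd : ∀ K, eLpNorm (M K) 1 P ≤ ((1 + B.toReal).toNNReal : ℝ≥0∞) := by
    intro K
    rw [eLpNorm_one_eq_lintegral_enorm, ← ofReal_integral_norm_eq_lintegral_enorm
      ((hM2 K).integrable one_le_two)]
    refine ENNReal.ofReal_le_ofReal ?_
    have i1 : Integrable (fun ω => M K ω ^ 2) P := (hM2 K).integrable_sq
    calc ∫ ω, ‖M K ω‖ ∂P ≤ ∫ ω, (1 + M K ω ^ 2) ∂P := by
          refine integral_mono ((hM2 K).integrable one_le_two).norm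
            ((integrable_const _).add i1) fun ω => ?_
          have := sq_abs (M K ω)
          simp only [Real.norm_eq_abs]
          nlinarith [sq_nonneg (|M K ω| - 1), abs_nonneg (M K ω)]
      _ ≤ 1 + B.toReal := by
          rw [integral_add (integrable_const _) i1]
          simpa using hvarB K
  filter_upwards [hmart.submartingale.exists_ae_tendsto_of_bdd hbdd] with ω hω
  simpa [hM] using hω

/-- Once the partial sums exceed `C` they stay above it, so all later terms are cut. The test
includes `a k` itself, so there is no overshoot; this is admissible for localization because the
quadratic variation is predictable. -/
theorem sum_range_ite_partialSum_le (a : ℕ → ℝ≥0∞) (C : ℝ≥0∞) (K : ℕ) :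
    ∑ k ∈ Finset.range K, (if ∑ i ∈ Finset.range (k + 1), a i ≤ C then a k else 0) ≤ C := by
  induction K with
  | zero => simp
  | succ K ih =>
    by_cases h : ∑ i ∈ Finset.range (K + 1), a i ≤ C
    · refine le_trans (Finset.sum_le_sum fun k _ => ?_) h
      split_ifs <;> simp
    · rw [Finset.sum_range_succ, if_neg h, add_zero]
      exact ih

/-- A martingale transform converges almost surely on the event where its predictable quadratic
variation is finite. -/
theorem ae_exists_tendsto_sum_mul_of_tsum_condLExp_ne_top [IsProbabilityMeasure P]
    (ℱ : Filtration ℕ m0) {ξ c : ℕ → Ω → ℝ} (hξ : ∀ k, Measurable[ℱ (k + 1)] (ξ k))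
    (hint : ∀ k, Integrable (ξ k) P) (hmds : ∀ k, P[ξ k | ℱ k] =ᵐ[P] 0)
    (hc : ∀ k, Measurable[ℱ k] (c k)) :
    ∀ᵐ ω ∂P, ∑' k, ‖c k ω‖ₑ ^ 2 * (P⁻[fun ω' => ‖ξ k ω'‖ₑ ^ 2 | ℱ k]) ω ≠ ∞ →
      ∃ l, Tendsto (fun K => ∑ k ∈ Finset.range K, c k ω * ξ k ω) atTop (𝓝 l) := by
  classical
  set a : ℕ → Ω → ℝ≥0∞ := fun k ω =>
    ‖c k ω‖ₑ ^ 2 * (P⁻[fun ω' => ‖ξ k ω'‖ₑ ^ 2 | ℱ k]) ω with ha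
  have hξ0 : ∀ k, Measurable (ξ k) := fun k => (hξ k).mono (ℱ.le _) le_rfl
  have hen : Measurable fun x : ℝ => ‖x‖ₑ ^ 2 := measurable_enorm.pow_const 2
  have ham : ∀ k, Measurable[ℱ k] (a k) := fun k =>
    (hen.comp (hc k)).mul (measurable_condLExp _ _ _)
  have hAm : ∀ (C : ℕ) k, MeasurableSet[ℱ k] {ω | ∑ i ∈ Finset.range (k + 1), a i ω ≤ C} := by
    intro C k
    have h : Measurable[ℱ k] fun ω => ∑ i ∈ Finset.range (k + 1), a i ω :=
      Finset.measurable_fun_sum _ fun i hi =>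
        (ham i).mono (ℱ.mono (Nat.lt_succ_iff.1 (Finset.mem_range.1 hi))) le_rfl
    exact h measurableSet_Iic
  have hC : ∀ C : ℕ, ∀ᵐ ω ∂P, ∃ l, Tendsto (fun K => ∑ k ∈ Finset.range K,
      (if ∑ i ∈ Finset.range (k + 1), a i ω ≤ C then c k ω else 0) * ξ k ω) atTop (𝓝 l) := by
    intro C
    have hcm : ∀ k, Measurable[ℱ k]
        (fun ω => if ∑ i ∈ Finset.range (k + 1), a i ω ≤ C then c k ω else 0) := fun k =>
      Measurable.ite (hAm C k) (hc k) measurable_const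
    refine ae_exists_tendsto_sum_mul_of_tsum_lintegral_ne_top ℱ hξ hint hmds hcm ?_
    have e : ∀ k, ∫⁻ ω, ‖if ∑ i ∈ Finset.range (k + 1), a i ω ≤ C then c k ω else 0‖ₑ ^ 2
        * ‖ξ k ω‖ₑ ^ 2 ∂P
        = ∫⁻ ω, (if ∑ i ∈ Finset.range (k + 1), a i ω ≤ C then a k ω else 0) ∂P := by
      intro k
      -- The truncated coefficient is `ℱ k`-measurable, so `‖ξ k‖²` may be replaced by its
      -- conditional expectation.
      refine (lintegral_mul_condLExp (ℱ.le k) (hen.comp (hcm k)) (hen.comp (hξ0 k))).symm.trans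
        (lintegral_congr fun ω => ?_)
      simp only [Function.comp_def]
      split_ifs <;> simp [ha]
    simp_rw [e]
    rw [← lintegral_tsum fun k => (Measurable.ite ((ℱ.le k) _ (hAm C k))
      ((ham k).mono (ℱ.le k) le_rfl) measurable_const).aemeasurable]
    refine ne_top_of_le_ne_top (ENNReal.natCast_ne_top C) ?_
    calc _ ≤ ∫⁻ _, (C : ℝ≥0∞) ∂P := by
          refine lintegral_mono fun ω => ENNReal.tsum_le_of_sum_range_le fun K => ?_
          exact sum_range_ite_partialSum_le (fun k => a k ω) C K
      _ = C := by simp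
  filter_upwards [ae_all_iff.2 hC] with ω hω hfin
  -- A level above the total variation at `ω`: there the truncation never acts.
  obtain ⟨C, hCω⟩ := ENNReal.exists_nat_gt hfin
  obtain ⟨l, hl⟩ := hω C
  refine ⟨l, ?_⟩
  have h : ∀ k, ∑ i ∈ Finset.range (k + 1), a i ω ≤ C := fun k =>
    (ENNReal.sum_le_tsum _).trans hCω.le
  simpa [h] using hl

end MartingaleConvergence

/-! ### Telescoping comparison and Abel summation -/

section RealSeries

/-- A discrete form of comparing with `∫ x^(-1-s)`; it follows from `exp x ≥ 1 + x` and `log x ≤ x -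
1` at `x = a / b`. -/
theorem sub_div_rpow_le {a b s : ℝ} (ha : 0 < a) (hb : 0 < b) (hs : 0 < s) :
    (b - a) / b ^ (1 + s) ≤ (a ^ (-s) - b ^ (-s)) / s := by
  have hlog : 1 + s * (1 - a / b) ≤ (a / b) ^ (-s) := by
    rw [Real.rpow_def_of_pos (div_pos ha hb)]
    have h1 := Real.add_one_le_exp (Real.log (a / b) * -s)
    have h2 := Real.log_le_sub_one_of_pos (div_pos ha hb)
    nlinarith
  have hbs : 0 < b ^ (-s) := Real.rpow_pos_of_pos hb _
  have e1 : (a / b) ^ (-s) * b ^ (-s) = a ^ (-s) := by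
    rw [← Real.mul_rpow (div_pos ha hb).le hb.le, div_mul_cancel₀ _ hb.ne']
  have e2 : (b - a) / b ^ (1 + s) = (1 - a / b) * b ^ (-s) := by
    rw [Real.rpow_add hb, Real.rpow_one, Real.rpow_neg hb.le]
    have := (Real.rpow_pos_of_pos hb s).ne'
    field_simp
  rw [e2, le_div_iff₀ hs, ← e1]
  nlinarith [mul_le_mul_of_nonneg_right hlog hbs.le]

theorem summable_sub_div_rpow {r : ℕ → ℝ} (hr : Monotone r) (h0 : 0 < r 0) {s : ℝ} (hs : 0 < s) :
    Summable fun k => (r (k + 1) - r k) / r (k + 1) ^ (1 + s) := by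
  have hpos : ∀ k, 0 < r k := fun k => h0.trans_le (hr (Nat.zero_le k))
  refine summable_of_sum_range_le (c := r 0 ^ (-s) / s) (fun k => ?_) fun K => ?_
  · exact div_nonneg (sub_nonneg.2 (hr (Nat.le_succ k))) (Real.rpow_nonneg (hpos _).le _)
  · calc _ ≤ ∑ k ∈ Finset.range K, (r k ^ (-s) / s - r (k + 1) ^ (-s) / s) :=
          Finset.sum_le_sum fun k _ =>
            (sub_div_rpow_le (hpos k) (hpos (k + 1)) hs).trans (sub_div _ _ _).le
      _ = r 0 ^ (-s) / s - r K ^ (-s) / s := Finset.sum_range_sub' (fun k => r k ^ (-s) / s) K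
      _ ≤ _ := sub_le_self _ (div_nonneg (Real.rpow_nonneg (hpos _).le _) hs.le)

/-- If `∑ b k` converges and `p` is nonnegative and nonincreasing, then `∑ p k * b k` has tails
that are `O(p k)` and tend to zero. -/
theorem exists_tail_of_antitone_mul {p b : ℕ → ℝ} (hp : Antitone p) (hp0 : ∀ k, 0 ≤ p k)
    {l : ℝ} (hb : Tendsto (fun K => ∑ k ∈ Finset.range K, b k) atTop (𝓝 l)) :
    ∃ S : ℕ → ℝ, (∀ k, S k = p k * b k + S (k + 1)) ∧ Tendsto S atTop (𝓝 0) ∧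
      ∃ C, 0 ≤ C ∧ ∀ k, |S k| ≤ C * p k := by
  set B : ℕ → ℝ := fun k => l - ∑ j ∈ Finset.range k, b j with hB
  have hBs : ∀ k, B k - B (k + 1) = b k := fun k => by
    simp only [hB, Finset.sum_range_succ]; ring
  have hB0 : Tendsto B atTop (𝓝 0) := by simpa [hB] using hb.const_sub l
  have hq : ∀ k, Summable fun j => p (k + j) - p (k + j + 1) := by
    intro k
    refine summable_of_sum_range_le (c := p k) (fun j => sub_nonneg.2 (hp (Nat.le_succ _)))
      fun K => ?_
    have := Finset.sum_range_sub' (fun j => p (k + j)) K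
    simp only [← add_assoc] at this
    rw [this]
    simpa using hp0 (k + K)
  have hqle : ∀ k, ∑' j, (p (k + j) - p (k + j + 1)) ≤ p k := by
    intro k
    refine Real.tsum_le_of_sum_range_le (fun j => sub_nonneg.2 (hp (Nat.le_succ _))) fun K => ?_
    have := Finset.sum_range_sub' (fun j => p (k + j)) K
    simp only [← add_assoc] at this
    rw [this]
    simpa using hp0 (k + K)
  have hterm : ∀ D k, (∀ j, k ≤ j → |B j| ≤ D) → ∀ j,
      ‖(p (k + j) - p (k + j + 1)) * B (k + j + 1)‖ ≤ (p (k + j) - p (k + j + 1)) * D := by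
    intro D k hD j
    rw [norm_mul, Real.norm_of_nonneg (sub_nonneg.2 (hp (Nat.le_succ _)))]
    exact mul_le_mul_of_nonneg_left (hD _ (by omega)) (sub_nonneg.2 (hp (Nat.le_succ _)))
  obtain ⟨D, hD⟩ : ∃ D, ∀ j, |B j| ≤ D := by
    obtain ⟨D, hD⟩ := hB0.abs.bddAbove_range
    exact ⟨D, fun j => hD ⟨j, rfl⟩⟩
  have hsumm : ∀ k, Summable fun j => (p (k + j) - p (k + j + 1)) * B (k + j + 1) := fun k =>
    Summable.of_norm_bounded ((hq k).mul_right D) (hterm D k fun j _ => hD j)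
  -- Summation by parts of `∑_{j ≥ k} p j (B j - B (j+1))`. If `|B| ≤ D` from `k` on, each of the
  -- two pieces is at most `D * p k`.
  set S : ℕ → ℝ := fun k => p k * B k - ∑' j, (p (k + j) - p (k + j + 1)) * B (k + j + 1) with hS
  have hbound : ∀ D k, 0 ≤ D → (∀ j, k ≤ j → |B j| ≤ D) → |S k| ≤ 2 * D * p k := by
    intro D k hD0 hD
    have h1 : |∑' j, (p (k + j) - p (k + j + 1)) * B (k + j + 1)| ≤ p k * D := by
      refine (tsum_of_norm_bounded ((hq k).mul_right D).hasSum (hterm D k hD)).trans ?_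
      rw [tsum_mul_right]
      exact mul_le_mul_of_nonneg_right (hqle k) hD0
    have h2 : |p k * B k| ≤ p k * D := by
      rw [abs_mul, abs_of_nonneg (hp0 k)]
      exact mul_le_mul_of_nonneg_left (hD k le_rfl) (hp0 k)
    calc |S k| ≤ _ := abs_sub _ _
      _ ≤ 2 * D * p k := by linarith
  refine ⟨S, fun k => ?_, ?_, 2 * D, ?_, fun k => hbound D k ((abs_nonneg _).trans (hD 0))
    fun j _ => hD j⟩
  · have := (hsumm k).tsum_eq_zero_add
    simp only [add_zero] at this
    have e : ∀ j, (p (k + (j + 1)) - p (k + (j + 1) + 1)) * B (k + (j + 1) + 1)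
        = (p (k + 1 + j) - p (k + 1 + j + 1)) * B (k + 1 + j + 1) := fun j => by
      rw [show k + (j + 1) = k + 1 + j by ring]
    simp only [e] at this
    simp only [hS, this, ← hBs k]
    ring
  · rw [Metric.tendsto_atTop]
    intro η hη
    have hη' : 0 < η / (2 * (p 0 + 1)) := div_pos hη (by linarith [hp0 0])
    obtain ⟨J, hJ⟩ := (Metric.tendsto_atTop.1 hB0) _ hη'
    refine ⟨J, fun k hk => ?_⟩
    have h := hbound _ k hη'.le fun j hj => by
      simpa using (hJ j (hk.trans hj)).le
    have hpk : p k < p 0 + 1 := (hp (Nat.zero_le k)).trans_lt (lt_add_one _)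
    rw [Real.dist_eq, sub_zero]
    refine h.trans_lt ?_
    calc _ < 2 * (η / (2 * (p 0 + 1))) * (p 0 + 1) :=
          mul_lt_mul_of_pos_left hpk (by linarith)
      _ = η := by have : p 0 + 1 ≠ 0 := by linarith [hp0 0]
                  field_simp
  · linarith [(abs_nonneg _).trans (hD 0)]

end RealSeries

/-! ### Stability of perturbed linear recursions -/

section LinearRecursion

variable {ι : Type*} [Fintype ι]

theorem posSemidef_mul_one_sub [DecidableEq ι] {H : Matrix ι ι ℝ} (h0 : H.PosSemidef) (h1 : (1 - H).PosSemidef) :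
    (H * (1 - H)).PosSemidef := by
  -- This writes the product as a sum of congruences of `1 - H` and `H`, with no square root.
  have e : H * (1 - H) = H * (1 - H) * Hᴴ + (1 - H) * H * (1 - H)ᴴ := by
    rw [h0.isHermitian.eq, h1.isHermitian.eq]
    noncomm_ring
  rw [e]
  exact (h1.mul_mul_conjTranspose_same H).add (h0.mul_mul_conjTranspose_same (1 - H))

/-- Operator convexity of the squared norm. -/
theorem dotProduct_convex_combination_le [DecidableEq ι] {H : Matrix ι ι ℝ}
    (h0 : H.PosSemidef) (h1 : (1 - H).PosSemidef) (f s : ι → ℝ) :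
    ((1 - H) *ᵥ f + H *ᵥ s) ⬝ᵥ ((1 - H) *ᵥ f + H *ᵥ s) ≤ f ⬝ᵥ f + s ⬝ᵥ H *ᵥ s := by
  have hsymm : ∀ u v, (H *ᵥ u) ⬝ᵥ v = u ⬝ᵥ H *ᵥ v := fun u v => by
    have hT : Hᵀ = H := by simpa using h0.isHermitian.eq
    rw [Matrix.dotProduct_mulVec, ← Matrix.mulVec_transpose, hT]
  have hf : 0 ≤ f ⬝ᵥ H *ᵥ f := by simpa using h0.dotProduct_mulVec_nonneg f
  -- The gap in the claimed inequality is exactly this quantity plus `f · H f`.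
  have hd : 0 ≤ (f - s) ⬝ᵥ (H * (1 - H)) *ᵥ (f - s) := by
    simpa using (posSemidef_mul_one_sub h0 h1).dotProduct_mulVec_nonneg (f - s)
  rw [← Matrix.mulVec_mulVec] at hd
  simp only [Matrix.sub_mulVec, Matrix.one_mulVec, Matrix.mulVec_sub,
    dotProduct_sub, dotProduct_add, sub_dotProduct, add_dotProduct, hsymm] at hd ⊢
  have c1 : s ⬝ᵥ H *ᵥ f = f ⬝ᵥ H *ᵥ s := by rw [← hsymm, dotProduct_comm]
  have c2 : s ⬝ᵥ H *ᵥ H *ᵥ f = f ⬝ᵥ H *ᵥ H *ᵥ s := by rw [← hsymm, ← hsymm, dotProduct_comm]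
  linarith

theorem tendsto_zero_of_tendsto_dotProduct_self {α : Type*} {l : Filter α} {f : α → ι → ℝ}
    (h : Tendsto (fun k => f k ⬝ᵥ f k) l (𝓝 0)) : Tendsto f l (𝓝 0) := by
  rw [tendsto_pi_nhds]
  intro i
  refine squeeze_zero_norm (fun k => ?_) (by simpa using (Real.continuous_sqrt.tendsto 0).comp h)
  rw [Real.norm_eq_abs, ← Real.sqrt_sq_eq_abs, sq]
  refine Real.sqrt_le_sqrt ?_
  exact Finset.single_le_sum (f := fun j => f k j * f k j) (fun j _ => mul_self_nonneg _)
    (Finset.mem_univ i)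

/-- Stability of a perturbed linear recursion: if the homogeneous part `Ψ` tends to zero and the
tails `S` of the perturbation have summable energy along `H`, then the solution tends to zero. -/
theorem tendsto_zero_of_recursion [DecidableEq ι] {H Ψ : ℕ → Matrix ι ι ℝ} {e w S : ℕ → ι → ℝ}
    (hH : ∀ k, (H k).PosSemidef) (hH1 : ∀ k, 1 ≤ k → (1 - H k).PosDef)
    (hdet : (1 - H 0).det ≠ 0) (hΨ0 : Ψ 0 = 1) (hΨ : ∀ k, Ψ (k + 1) = (1 - H k) * Ψ k)
    (hΨlim : Tendsto Ψ atTop (𝓝 0)) (he : ∀ k, e (k + 1) = (1 - H k) *ᵥ e k + w k)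
    (hS : ∀ k, S k = w k + S (k + 1)) (hSlim : Tendsto S atTop (𝓝 0))
    (hsum : Summable fun k => S k ⬝ᵥ H k *ᵥ S k) : Tendsto e atTop (𝓝 0) := by
  have hunit : ∀ k, (Ψ k).det ≠ 0 := by
    intro k
    induction k with
    | zero => simp [hΨ0]
    | succ k ih =>
      rw [hΨ, Matrix.det_mul]
      refine mul_ne_zero ?_ ih
      rcases Nat.eq_zero_or_pos k with rfl | hk
      · exact hdet
      · exact (hH1 k hk).det_pos.ne'
  set f : ℕ → ι → ℝ := fun k => e k + S k with hf
  have hfs : ∀ k, f (k + 1) = (1 - H k) *ᵥ f k + H k *ᵥ S k := by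
    intro k
    simp only [hf, he, Matrix.mulVec_add, Matrix.sub_mulVec, Matrix.one_mulVec]
    rw [add_assoc _ (w k), ← hS k]
    abel
  have hq : ∀ k, 0 ≤ S k ⬝ᵥ H k *ᵥ S k := fun k => by
    simpa using (hH k).dotProduct_mulVec_nonneg (S k)
  have hflim : Tendsto (fun k => f k ⬝ᵥ f k) atTop (𝓝 0) := by
    have htail := tendsto_sum_nat_add fun k => S k ⬝ᵥ H k *ᵥ S k
    rw [Metric.tendsto_atTop]
    intro η hη
    -- `1 ≤ J` because `1 - H 0` is only known to be nonsingular, so the convexity bound may fail at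
    -- time zero.
    obtain ⟨J, hJ1, hJ⟩ : ∃ J, 1 ≤ J ∧ ∑' k, S (k + J) ⬝ᵥ H (k + J) *ᵥ S (k + J) < η / 4 :=
      ((eventually_ge_atTop 1).and (htail.eventually_lt_const (by positivity))).exists
    -- Chosen so that `Ψ k *ᵥ v` equals `f` at time `J`; then `g` starts at zero.
    set v := (Ψ J)⁻¹ *ᵥ f J with hv
    set g : ℕ → ι → ℝ := fun k => f (k + J) - Ψ (k + J) *ᵥ v with hg
    have hgs : ∀ k, g (k + 1) = (1 - H (k + J)) *ᵥ g k + H (k + J) *ᵥ S (k + J) := by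
      intro k
      simp only [hg]
      rw [show k + 1 + J = k + J + 1 by ring, hfs, hΨ, ← Matrix.mulVec_mulVec, Matrix.mulVec_sub]
      abel
    have hg0 : g 0 = 0 := by
      simp only [hg, hv, zero_add, Matrix.mulVec_mulVec,
        Matrix.mul_nonsing_inv _ (isUnit_iff_ne_zero.2 (hunit J)), Matrix.one_mulVec, sub_self]
    have hgle : ∀ k, g k ⬝ᵥ g k
        ≤ ∑ j ∈ Finset.range k, S (j + J) ⬝ᵥ H (j + J) *ᵥ S (j + J) := by
      intro k
      induction k with
      | zero => simp [hg0]
      | succ k ih =>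
        rw [hgs, Finset.sum_range_succ]
        exact (dotProduct_convex_combination_le (hH _) (hH1 _ (by omega)).posSemidef _ _).trans
          (by linarith)
    have hgη : ∀ k, g k ⬝ᵥ g k < η / 4 := fun k =>
      ((hgle k).trans (((summable_nat_add_iff J).2 hsum).sum_le_tsum _ fun j _ => hq _)).trans_lt
        hJ
    have hΨv : Tendsto (fun k => (Ψ k *ᵥ v) ⬝ᵥ (Ψ k *ᵥ v)) atTop (𝓝 0) := by
      have hcont : Continuous fun A : Matrix ι ι ℝ => (A *ᵥ v) ⬝ᵥ (A *ᵥ v) := by fun_prop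
      simpa [Function.comp_def] using (hcont.tendsto 0).comp hΨlim
    obtain ⟨K, hK⟩ := eventually_atTop.1 (hΨv.eventually_lt_const (u := η / 4) (by positivity))
    refine ⟨K + J, fun k hk => ?_⟩
    obtain ⟨j, rfl⟩ : ∃ j, k = j + J := ⟨k - J, by omega⟩
    have h0 : 0 ≤ f (j + J) ⬝ᵥ f (j + J) := Finset.sum_nonneg fun i _ => mul_self_nonneg _
    rw [Real.dist_eq, sub_zero, abs_of_nonneg h0]
    have h1 := hgη j
    have h2 := hK (j + J) (by omega)
    have h3 : f (j + J) = g j + Ψ (j + J) *ᵥ v := by simp [hg]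
    -- This gives `|a + b|² ≤ 2|a|² + 2|b|²`, which accounts for the two `η / 4`.
    have h4 : 0 ≤ (g j - Ψ (j + J) *ᵥ v) ⬝ᵥ (g j - Ψ (j + J) *ᵥ v) :=
      Finset.sum_nonneg fun i _ => mul_self_nonneg _
    rw [h3]
    simp only [dotProduct_sub, dotProduct_add, sub_dotProduct, add_dotProduct] at h4 ⊢
    linarith
  have := (tendsto_zero_of_tendsto_dotProduct_self hflim).sub hSlim
  simpa [hf] using this

end LinearRecursion

/-! ### Bounds on `G_k` and the error recursion -/

section MatrixFacts

variable {n m : ℕ} (N : SensorNetwork n) (φ : RegressorPath n m)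

theorem SensorNetwork.weight_nonneg (i j : Fin n) : 0 ≤ N.weight i j := by
  by_cases hij : i = j
  · exact hij ▸ N.weight_self_nonneg i
  · by_cases h : N.graph.Adj i j
    · exact (N.weight_pos i j h).le
    · exact (N.weight_eq_zero i j hij h).ge

theorem SensorNetwork.weight_comm (i j : Fin n) : N.weight i j = N.weight j i :=
  N.weight_symm.apply j i

theorem SensorNetwork.sum_nbhd {E : Type*} [AddCommGroup E] [Module ℝ E] (i : Fin n)
    (f : Fin n → E) : ∑ j ∈ N.nbhd i, N.weight i j • f j = ∑ j, N.weight i j • f j := by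
  refine Finset.sum_subset (Finset.subset_univ _) fun j _ hj => ?_
  have hj' : ¬ N.graph.Adj i j ∧ j ≠ i := by simpa [SensorNetwork.nbhd] using hj
  rw [N.weight_eq_zero i j hj'.2.symm hj'.1, zero_smul]

theorem SensorNetwork.sum_nbhd_sub {E : Type*} [AddCommGroup E] [Module ℝ E] (i : Fin n)
    (f : Fin n → E) :
    ∑ j ∈ N.nbhd i, N.weight i j • (f i - f j) = ∑ j, (1 - N.weight) i j • f j := by
  rw [N.sum_nbhd i fun j => f i - f j]
  simp only [smul_sub, Finset.sum_sub_distrib, ← Finset.sum_smul, N.weight_row_sum, one_smul,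
    Matrix.sub_apply, sub_smul, Matrix.one_apply, ite_smul, zero_smul, Finset.sum_ite_eq,
    Finset.mem_univ, if_true]

theorem one_le_gain (k : ℕ) (i : Fin n) : 1 ≤ gain φ k i :=
  le_add_of_nonneg_right (Finset.sum_nonneg fun _ _ => sq_nonneg _)

theorem gain_pos (k : ℕ) (i : Fin n) : 0 < gain φ k i := one_pos.trans_le (one_le_gain φ k i)

theorem gain_succ (k : ℕ) (i : Fin n) : gain φ (k + 1) i = gain φ k i + ‖φ (k + 1) i‖ ^ 2 := by
  rw [gain, gain, Finset.sum_Icc_succ_top (by omega), add_assoc]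

theorem gain_mono (i : Fin n) : Monotone fun k => gain φ k i :=
  monotone_nat_of_le_succ fun k => by
    rw [gain_succ]
    exact le_add_of_nonneg_right (sq_nonneg _)

/-- The gain at time `k ≥ 1` contains `‖φ k i‖²`. At time zero it is `1`, which is why the first
factor needs its own nonsingularity assumption. -/
theorem norm_sq_div_gain_le_one {k : ℕ} (hk : 1 ≤ k) (i : Fin n) :
    ‖φ k i‖ ^ 2 / gain φ k i ≤ 1 := by
  rw [div_le_one (gain_pos φ k i)]
  obtain ⟨k, rfl⟩ := Nat.exists_eq_add_of_le' hk
  rw [gain_succ]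
  exact le_add_of_nonneg_left (gain_pos φ k i).le

theorem diffusion_nonneg (k q : ℕ) (i : Fin n) : 0 ≤ diffusion N φ k q i := by
  induction q generalizing i with
  | zero => exact div_nonneg (sq_nonneg _) (gain_pos φ k i).le
  | succ q ih => exact Finset.sum_nonneg fun j _ => mul_nonneg (N.weight_nonneg i j) (ih j)

/-- Averaging with stochastic weights cannot raise a maximum. -/
theorem diffusion_le {k : ℕ} {X : ℝ} (hX : ∀ i, ‖φ k i‖ ^ 2 / gain φ k i ≤ X) (q : ℕ)
    (i : Fin n) : diffusion N φ k q i ≤ X := by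
  induction q generalizing i with
  | zero => exact hX i
  | succ q ih =>
    have h := N.sum_nbhd i (diffusion N φ k q)
    simp only [smul_eq_mul] at h
    calc _ = _ := h
      _ ≤ ∑ j, N.weight i j * X :=
          Finset.sum_le_sum fun j _ => mul_le_mul_of_nonneg_left (ih j) (N.weight_nonneg i j)
      _ = X := by rw [← Finset.sum_mul, N.weight_row_sum, one_mul]

theorem gainMatrix_inv (k : ℕ) :
    (gainMatrix φ k)⁻¹ = Matrix.diagonal fun i => (gain φ k i)⁻¹ := by
  refine Matrix.inv_eq_right_inv ?_
  rw [gainMatrix, Matrix.diagonal_mul_diagonal]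
  simp [mul_inv_cancel₀ (gain_pos φ k _).ne']

theorem regMatrix_transpose_mulVec (k : ℕ) (v : Fin n × Fin m → ℝ) (i : Fin n) :
    ((regMatrix φ k)ᵀ *ᵥ v) i = ∑ b, φ k i b * v (i, b) := by
  simp [Matrix.mulVec, dotProduct, regMatrix, Fintype.sum_prod_type, ite_mul,
    Finset.sum_ite_irrel, Finset.sum_ite_eq']

theorem regMatrix_mulVec (k : ℕ) (u : Fin n → ℝ) (i : Fin n) (a : Fin m) :
    (regMatrix φ k *ᵥ u) (i, a) = φ k i a * u i := by
  simp [Matrix.mulVec, dotProduct, regMatrix, ite_mul]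

theorem kronecker_one_mulVec (A : Matrix (Fin n) (Fin n) ℝ) (v : Fin n × Fin m → ℝ) (i : Fin n)
    (a : Fin m) :
    ((A ⊗ₖ (1 : Matrix (Fin m) (Fin m) ℝ)) *ᵥ v) (i, a) = ∑ j, A i j * v (j, a) := by
  simp [Matrix.mulVec, dotProduct, Fintype.sum_prod_type, Matrix.one_apply]

theorem gMatrix_mulVec (ν : ℝ) (Q k : ℕ) (v : Fin n × Fin m → ℝ) (i : Fin n) (a : Fin m) :
    (gMatrix N ν Q φ k *ᵥ v) (i, a) =
      φ k i a * ((gain φ k i)⁻¹ * ∑ b, φ k i b * v (i, b)) +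
        ν * ∑ j, (1 - N.weight) i j *
          (diffusion N φ k Q j * ∑ l, (1 - N.weight) j l * v (l, a)) := by
  rw [gMatrix, Matrix.add_mulVec, Matrix.smul_mulVec, ← Matrix.mulVec_mulVec,
    ← Matrix.mulVec_mulVec, ← Matrix.mulVec_mulVec, ← Matrix.mulVec_mulVec, gainMatrix_inv,
    Pi.add_apply, regMatrix_mulVec, Matrix.mulVec_diagonal, regMatrix_transpose_mulVec,
    Pi.smul_apply, smul_eq_mul, bigLaplacian, kronecker_one_mulVec]
  simp only [kronecker_one_mulVec, Matrix.diagonal_apply, ite_mul, zero_mul, Finset.sum_ite_eq,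
    Finset.mem_univ, if_true]

theorem bigLaplacian_isHermitian : (bigLaplacian N m).IsHermitian := by
  rw [Matrix.IsHermitian, bigLaplacian, Matrix.conjTranspose_kronecker]
  simp [N.weight_symm.eq]

theorem gMatrix_posSemidef {ν : ℝ} (hν : 0 ≤ ν) (Q k : ℕ) : (gMatrix N ν Q φ k).PosSemidef := by
  refine Matrix.PosSemidef.add ?_ (Matrix.PosSemidef.smul ?_ hν)
  · rw [gainMatrix_inv, ← Matrix.conjTranspose_eq_transpose_of_trivial]
    exact (Matrix.PosSemidef.diagonal fun i =>
      inv_nonneg.2 (gain_pos φ k i).le).mul_mul_conjTranspose_same _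
  · nth_rewrite 2 [← (bigLaplacian_isHermitian N).eq]
    exact ((Matrix.PosSemidef.diagonal (diffusion_nonneg N φ k Q)).kronecker
      Matrix.PosSemidef.one).mul_mul_conjTranspose_same _

theorem dotProduct_gMatrix_mulVec (ν : ℝ) (Q k : ℕ) (v : Fin n × Fin m → ℝ) :
    v ⬝ᵥ gMatrix N ν Q φ k *ᵥ v =
      ∑ i, (gain φ k i)⁻¹ * (∑ b, φ k i b * v (i, b)) ^ 2 +
        ν * ∑ i, diffusion N φ k Q i * ∑ a, (∑ l, (1 - N.weight) i l * v (l, a)) ^ 2 := by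
  have hL : v ᵥ* bigLaplacian N m = bigLaplacian N m *ᵥ v := by
    rw [← Matrix.mulVec_transpose]
    congr 1
    simpa using (bigLaplacian_isHermitian N (m := m)).eq
  rw [gMatrix, Matrix.add_mulVec, Matrix.smul_mulVec, dotProduct_add, dotProduct_smul,
    ← Matrix.mulVec_mulVec, ← Matrix.mulVec_mulVec, ← Matrix.mulVec_mulVec,
    ← Matrix.mulVec_mulVec, gainMatrix_inv, Matrix.dotProduct_mulVec,
    Matrix.dotProduct_mulVec v (bigLaplacian N m), hL, ← Matrix.mulVec_transpose, smul_eq_mul]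
  congr 1
  · refine Finset.sum_congr rfl fun i _ => ?_
    rw [Matrix.mulVec_diagonal, regMatrix_transpose_mulVec]
    ring
  · congr 1
    rw [dotProduct, Fintype.sum_prod_type]
    refine Finset.sum_congr rfl fun i _ => ?_
    rw [Finset.mul_sum]
    refine Finset.sum_congr rfl fun a _ => ?_
    simp only [bigLaplacian, kronecker_one_mulVec, Matrix.diagonal_apply, ite_mul, zero_mul,
      Finset.sum_ite_eq, Finset.mem_univ, if_true]
    ring

/-- Jensen's inequality on each row, then unit column sums from symmetry. -/
theorem sum_laplacian_sq_le (u : Fin n → ℝ) :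
    ∑ i, (∑ l, (1 - N.weight) i l * u l) ^ 2 ≤ 4 * ∑ i, u i ^ 2 := by
  have h1 : ∀ i, (∑ l, (1 - N.weight) i l * u l) ^ 2
      ≤ 2 * u i ^ 2 + 2 * ∑ l, N.weight i l * u l ^ 2 := by
    intro i
    have e : ∑ l, (1 - N.weight) i l * u l = u i - ∑ l, N.weight i l * u l := by
      simp [Matrix.sub_apply, sub_mul, Finset.sum_sub_distrib, Matrix.one_apply]
    have hJ : (∑ l, N.weight i l * u l) ^ 2 ≤ (∑ l, N.weight i l) * ∑ l, N.weight i l * u l ^ 2 :=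
      Finset.sum_sq_le_sum_mul_sum_of_sq_le_mul _ (fun l _ => N.weight_nonneg i l)
        (fun l _ => mul_nonneg (N.weight_nonneg i l) (sq_nonneg _)) fun l _ => le_of_eq (by ring)
    rw [N.weight_row_sum, one_mul] at hJ
    rw [e]
    nlinarith [sq_nonneg (u i + ∑ l, N.weight i l * u l)]
  refine (Finset.sum_le_sum fun i _ => h1 i).trans (le_of_eq ?_)
  rw [Finset.sum_add_distrib, ← Finset.mul_sum, ← Finset.mul_sum, Finset.sum_comm]
  have : ∀ l, ∑ i, N.weight i l * u l ^ 2 = u l ^ 2 := fun l => by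
    simp_rw [N.weight_comm _ l, ← Finset.sum_mul, N.weight_row_sum, one_mul]
  simp_rw [this]
  ring

/-- The bound `X` stays free for two uses: `X = 1` gives positivity of `1 - μ G_k`, and the sum of
the ratios gives summable energy. -/
theorem dotProduct_gMatrix_mulVec_le {ν : ℝ} (hν : 0 ≤ ν) (Q : ℕ) {k : ℕ} {X : ℝ} (hX0 : 0 ≤ X)
    (hX : ∀ i, ‖φ k i‖ ^ 2 / gain φ k i ≤ X) (v : Fin n × Fin m → ℝ) :
    v ⬝ᵥ gMatrix N ν Q φ k *ᵥ v ≤ (1 + 4 * ν) * X * (v ⬝ᵥ v) := by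
  have hvv : v ⬝ᵥ v = ∑ i, ∑ a, v (i, a) ^ 2 := by
    simp [dotProduct, Fintype.sum_prod_type, sq]
  have h1 : ∑ i, (gain φ k i)⁻¹ * (∑ b, φ k i b * v (i, b)) ^ 2 ≤ X * (v ⬝ᵥ v) := by
    rw [hvv, Finset.mul_sum]
    refine Finset.sum_le_sum fun i _ => ?_
    have hCS := Finset.sum_mul_sq_le_sq_mul_sq Finset.univ (fun b => φ k i b) fun b => v (i, b)
    rw [← EuclideanSpace.real_norm_sq_eq] at hCS
    calc _ ≤ (gain φ k i)⁻¹ * (‖φ k i‖ ^ 2 * ∑ b, v (i, b) ^ 2) :=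
          mul_le_mul_of_nonneg_left hCS (inv_nonneg.2 (gain_pos φ k i).le)
      _ = ‖φ k i‖ ^ 2 / gain φ k i * ∑ b, v (i, b) ^ 2 := by ring
      _ ≤ _ := mul_le_mul_of_nonneg_right (hX i) (Finset.sum_nonneg fun _ _ => sq_nonneg _)
  have h2 : ∑ i, diffusion N φ k Q i * ∑ a, (∑ l, (1 - N.weight) i l * v (l, a)) ^ 2
      ≤ X * (4 * (v ⬝ᵥ v)) := by
    calc _ ≤ ∑ i, X * ∑ a, (∑ l, (1 - N.weight) i l * v (l, a)) ^ 2 :=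
          Finset.sum_le_sum fun i _ => mul_le_mul_of_nonneg_right (diffusion_le N φ hX Q i)
            (Finset.sum_nonneg fun _ _ => sq_nonneg _)
      _ = X * ∑ a, ∑ i, (∑ l, (1 - N.weight) i l * v (l, a)) ^ 2 := by
          rw [← Finset.mul_sum, Finset.sum_comm]
      _ ≤ X * ∑ a, 4 * ∑ i, v (i, a) ^ 2 := by
          refine mul_le_mul_of_nonneg_left (Finset.sum_le_sum fun a _ => ?_) hX0
          exact sum_laplacian_sq_le N fun i => v (i, a)
      _ = _ := by rw [hvv, Finset.sum_comm, ← Finset.mul_sum]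
  rw [dotProduct_gMatrix_mulVec]
  nlinarith [mul_le_mul_of_nonneg_left h2 hν]

theorem one_sub_smul_gMatrix_posDef {μ ν : ℝ} (hμ : 0 ≤ μ) (hν : 0 ≤ ν)
    (hμν : μ * (1 + 4 * ν) < 1) (Q : ℕ) {k : ℕ} (hk : 1 ≤ k) :
    (1 - μ • gMatrix N ν Q φ k).PosDef := by
  have hG := gMatrix_posSemidef N φ hν Q k
  refine Matrix.PosDef.of_dotProduct_mulVec_pos
    (Matrix.isHermitian_one.sub (hG.smul hμ).isHermitian) fun v hv => ?_
  have hvv : 0 < v ⬝ᵥ v := by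
    have h0 : 0 ≤ v ⬝ᵥ v := Finset.sum_nonneg fun i _ => mul_self_nonneg _
    exact lt_of_le_of_ne h0 fun h => hv (dotProduct_self_eq_zero.1 h.symm)
  have h := dotProduct_gMatrix_mulVec_le N φ hν Q zero_le_one (norm_sq_div_gain_le_one φ hk) v
  simp only [star_trivial, Matrix.sub_mulVec, Matrix.one_mulVec, Matrix.smul_mulVec,
    dotProduct_sub, dotProduct_smul, smul_eq_mul]
  nlinarith [mul_le_mul_of_nonneg_left h hμ]

/-- The stacked estimation error `Θ̂_k - Θ`. -/
noncomputable def errorVec (μ ν : ℝ) (Q : ℕ) (y : ℕ → Fin n → ℝ)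
    (T₀ : Fin n → EuclideanSpace ℝ (Fin m)) (θ : EuclideanSpace ℝ (Fin m)) (k : ℕ)
    (p : Fin n × Fin m) : ℝ :=
  estimate N μ ν Q φ y T₀ k p.1 p.2 - θ p.2

theorem errorVec_succ (μ ν : ℝ) (Q : ℕ) (y ε : ℕ → Fin n → ℝ)
    (T₀ : Fin n → EuclideanSpace ℝ (Fin m)) (θ : EuclideanSpace ℝ (Fin m))
    (hy : ∀ k i, y (k + 1) i = inner ℝ θ (φ k i) + ε (k + 1) i) (k : ℕ) :
    errorVec N φ μ ν Q y T₀ θ (k + 1) =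
      (1 - μ • gMatrix N ν Q φ k) *ᵥ errorVec N φ μ ν Q y T₀ θ k +
        fun p => μ * (φ k p.1 p.2 / gain φ k p.1) * ε (k + 1) p.1 := by
  ext ⟨i, a⟩
  set T := estimate N μ ν Q φ y T₀ k with hT
  have hz : ∀ j, localDisagreement N φ Q k T j =
      diffusion N φ k Q j • ∑ l, (1 - N.weight) j l • T l := by
    intro j
    rw [localDisagreement, ← N.sum_nbhd_sub j T]
    simp_rw [N.weight_comm _ j]
  -- The Laplacian annihilates the consensus vector `Θ`.
  have hLθ : ∀ j, ∑ l, (1 - N.weight) j l * (T l a - θ a) = ∑ l, (1 - N.weight) j l * T l a := by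
    intro j
    have : ∑ l, (1 - N.weight) j l = 0 := by
      simp [Matrix.sub_apply, Finset.sum_sub_distrib, N.weight_row_sum, Matrix.one_apply]
    simp_rw [mul_sub, Finset.sum_sub_distrib, ← Finset.sum_mul, this, zero_mul, sub_zero]
  have hin : ∀ x : EuclideanSpace ℝ (Fin m), inner ℝ (φ k i) x = ∑ b, φ k i b * x b := fun x => by
    simp [PiLp.inner_apply, mul_comm]
  have hest : estimate N μ ν Q φ y T₀ (k + 1) i a = T i a +
      μ / gain φ k i * (y (k + 1) i - inner ℝ (φ k i) (T i)) * φ k i a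
        - μ * ν * ∑ j, (1 - N.weight) i j *
          (diffusion N φ k Q j * ∑ l, (1 - N.weight) j l * T l a) := by
    rw [estimate]
    simp only [← hT]
    rw [N.sum_nbhd_sub i (localDisagreement N φ Q k T)]
    simp [hz, Finset.mul_sum]
  rw [errorVec, hest, Matrix.sub_mulVec, Matrix.one_mulVec, Matrix.smul_mulVec, Pi.add_apply,
    Pi.sub_apply, Pi.smul_apply, gMatrix_mulVec, hy, real_inner_comm, hin θ, hin (T i)]
  simp only [errorVec, ← hT, hLθ, smul_eq_mul]
  simp only [mul_sub, Finset.sum_sub_distrib]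
  ring

theorem transition_succ (μ ν : ℝ) (Q k : ℕ) :
    transition N μ ν Q φ 0 (k + 1) = (1 - μ • gMatrix N ν Q φ k) * transition N μ ν Q φ 0 k := by
  simp [transition]

end MatrixFacts

/-! ### Pathwise arguments for a fixed realization -/

section Path

variable {n m : ℕ} (N : SensorNetwork n) (φ : RegressorPath n m)

theorem gain_le_mul_gain {γ : ℝ} {k : ℕ} (h : (⨆ i, gain φ k i) / (⨅ i, gain φ k i) ≤ γ)
    (i j : Fin n) : gain φ k i ≤ γ * gain φ k j := by
  have : Nonempty (Fin n) := ⟨i⟩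
  have hinf : 0 < ⨅ i, gain φ k i := one_pos.trans_le (le_ciInf fun i => one_le_gain φ k i)
  have hsup : gain φ k i ≤ ⨆ i, gain φ k i := le_ciSup (Set.finite_range _).bddAbove i
  have hγ : 0 ≤ γ := le_trans (div_nonneg ((gain_pos φ k i).le.trans hsup) hinf.le) h
  calc gain φ k i ≤ γ * ⨅ i, gain φ k i := hsup.trans ((div_le_iff₀ hinf).1 h)
    _ ≤ γ * gain φ k j :=
      mul_le_mul_of_nonneg_left (ciInf_le (Set.finite_range _).bddBelow j) hγ

theorem norm_gainMatrix_le {γ : ℝ} {k : ℕ} (h : ∀ i j, gain φ k i ≤ γ * gain φ k j)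
    (j : Fin n) : ‖gainMatrix φ k‖ ≤ γ * gain φ k j := by
  rw [gainMatrix, Matrix.l2_opNorm_diagonal]
  refine (pi_norm_le_iff_of_nonneg ((gain_pos φ k j).le.trans (h j j))).2 fun i => ?_
  rw [Real.norm_of_nonneg (gain_pos φ k i).le]
  exact h i j

theorem summable_norm_sq_div_gain_rpow (i : Fin n) {s : ℝ} (hs : 0 < s) :
    Summable fun k => ‖φ k i‖ ^ 2 / gain φ k i ^ (1 + s) := by
  rw [← summable_nat_add_iff 1]
  refine (summable_sub_div_rpow (gain_mono φ i) (gain_pos φ 0 i) hs).congr fun k => ?_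
  rw [gain_succ, add_sub_cancel_left]

/-- The weight `φ^i_k(a) / (r^i_k)^{1-δ}` in front of the noise. -/
noncomputable def noiseCoeff (δ : ℝ) (k : ℕ) (i : Fin n) (a : Fin m) : ℝ :=
  φ k i a / gain φ k i * gain φ k i ^ δ

theorem noiseCoeff_sq_le (δ : ℝ) (k : ℕ) (i : Fin n) (a : Fin m) :
    noiseCoeff φ δ k i a ^ 2 ≤ ‖φ k i‖ ^ 2 * gain φ k i ^ (2 * δ - 2) := by
  have hr := gain_pos φ k i
  have e : noiseCoeff φ δ k i a ^ 2 = φ k i a ^ 2 * gain φ k i ^ (2 * δ - 2) := by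
    rw [Real.rpow_sub hr, mul_comm 2 δ, Real.rpow_mul hr.le, Real.rpow_two, Real.rpow_two,
      noiseCoeff]
    ring
  rw [e]
  refine mul_le_mul_of_nonneg_right ?_ (Real.rpow_nonneg hr.le _)
  rw [EuclideanSpace.real_norm_sq_eq]
  exact Finset.single_le_sum (f := fun b => φ k i b ^ 2) (fun b _ => sq_nonneg _)
    (Finset.mem_univ a)

/-- Replacing `‖R_k‖` by `γ r^i_k` leaves `‖φ‖² r^(2δ - 2 + e)`, whose exponent is below `-1`
exactly when `2δ < 1 - e`. -/
theorem tsum_noiseCoeff_sq_mul_ne_top {V : ℕ → ENNReal} {c₀ e γ δ : ℝ} (hc₀ : 0 ≤ c₀)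
    (he : 0 ≤ e) (hδ : 2 * δ < 1 - e) (hγ : 0 ≤ γ) (hg : ∀ k i j, gain φ k i ≤ γ * gain φ k j)
    (hV : ∀ k, V k ≤ ENNReal.ofReal (c₀ * ‖gainMatrix φ k‖ ^ e)) (i : Fin n) (a : Fin m) :
    ∑' k, ‖noiseCoeff φ δ k i a‖ₑ ^ 2 * V k ≠ ⊤ := by
  have hs : 0 < 1 - e - 2 * δ := by linarith
  have hle : ∀ k, ‖noiseCoeff φ δ k i a‖ₑ ^ 2 * V k ≤
      ENNReal.ofReal (c₀ * γ ^ e * (‖φ k i‖ ^ 2 / gain φ k i ^ (1 + (1 - e - 2 * δ)))) := by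
    intro k
    have hr := gain_pos φ k i
    rw [← enorm_pow, Real.enorm_of_nonneg (sq_nonneg _)]
    refine (mul_le_mul_right (hV k) _).trans ?_
    rw [← ENNReal.ofReal_mul (sq_nonneg _)]
    refine ENNReal.ofReal_le_ofReal ?_
    have h1 : ‖gainMatrix φ k‖ ^ e ≤ γ ^ e * gain φ k i ^ e := by
      rw [← Real.mul_rpow hγ hr.le]
      exact Real.rpow_le_rpow (norm_nonneg _) (norm_gainMatrix_le φ (hg k) i) he
    calc _ ≤ (‖φ k i‖ ^ 2 * gain φ k i ^ (2 * δ - 2)) * (c₀ * (γ ^ e * gain φ k i ^ e)) := by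
          refine mul_le_mul (noiseCoeff_sq_le φ δ k i a) (mul_le_mul_of_nonneg_left h1 hc₀)
            (mul_nonneg hc₀ (Real.rpow_nonneg (norm_nonneg _) _)) ?_
          exact mul_nonneg (sq_nonneg _) (Real.rpow_nonneg hr.le _)
      _ = c₀ * γ ^ e * (‖φ k i‖ ^ 2 * (gain φ k i ^ (2 * δ - 2) * gain φ k i ^ e)) := by ring
      _ = _ := by
          rw [← Real.rpow_add hr, div_eq_mul_inv, ← Real.rpow_neg hr.le]
          congr 3
          ring
  refine ne_top_of_le_ne_top ?_ (ENNReal.tsum_le_tsum hle)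
  exact ((summable_norm_sq_div_gain_rpow φ i hs).mul_left _).tsum_ofReal_ne_top

theorem tendsto_estimate_iff (μ ν : ℝ) (Q : ℕ) (y : ℕ → Fin n → ℝ)
    (T₀ : Fin n → EuclideanSpace ℝ (Fin m)) (θ : EuclideanSpace ℝ (Fin m)) :
    Tendsto (estimate N μ ν Q φ y T₀) atTop (𝓝 fun _ => θ) ↔
      Tendsto (errorVec N φ μ ν Q y T₀ θ) atTop (𝓝 0) := by
  constructor
  · intro h
    rw [tendsto_pi_nhds] at h ⊢
    rintro ⟨i, a⟩
    have h1 := ((continuous_apply a).comp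
      (PiLp.continuous_ofLp 2 fun _ : Fin m => ℝ)).continuousAt.tendsto.comp (h i)
    simpa [errorVec, Function.comp_def] using h1.sub_const (θ a)
  · intro h
    rw [tendsto_pi_nhds] at h ⊢
    intro i
    have h1 : Tendsto (fun k a => estimate N μ ν Q φ y T₀ k i a) atTop (𝓝 fun a => θ a) := by
      rw [tendsto_pi_nhds]
      intro a
      simpa [errorVec] using (h (i, a)).add_const (θ a)
    exact (PiLp.continuous_toLp 2 fun _ : Fin m => ℝ).continuousAt.tendsto.comp h1

/-- Both runs see the same noise, which cancels in the difference, as does `θ` in the initial error.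
-/
theorem transition_mulVec_eq_errorVec_sub (μ ν : ℝ) (Q : ℕ) (y ε : ℕ → Fin n → ℝ)
    (θ : EuclideanSpace ℝ (Fin m))
    (hy : ∀ k i, y (k + 1) i = inner ℝ θ (φ k i) + ε (k + 1) i) (d : Fin n × Fin m → ℝ) (k : ℕ) :
    transition N μ ν Q φ 0 k *ᵥ d =
      errorVec N φ μ ν Q y (fun i => WithLp.toLp 2 fun a => d (i, a)) θ k -
        errorVec N φ μ ν Q y 0 θ k := by
  induction k with
  | zero =>
    ext ⟨i, a⟩
    simp [transition, errorVec, estimate]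
  | succ k ih =>
    rw [transition_succ, ← Matrix.mulVec_mulVec, ih, errorVec_succ N φ μ ν Q y ε _ θ hy,
      errorVec_succ N φ μ ν Q y ε _ θ hy, Matrix.mulVec_sub]
    abel

theorem tendsto_transition_of_tendsto_errorVec (μ ν : ℝ) (Q : ℕ) (y ε : ℕ → Fin n → ℝ)
    (θ : EuclideanSpace ℝ (Fin m))
    (hy : ∀ k i, y (k + 1) i = inner ℝ θ (φ k i) + ε (k + 1) i)
    (h0 : Tendsto (errorVec N φ μ ν Q y 0 θ) atTop (𝓝 0))
    (h : ∀ p : Fin n × Fin m, Tendsto (errorVec N φ μ ν Q y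
      (fun i => WithLp.toLp 2 fun a => (Pi.single p 1 : Fin n × Fin m → ℝ) (i, a)) θ) atTop
        (𝓝 0)) :
    Tendsto (transition N μ ν Q φ 0) atTop (𝓝 0) := by
  refine tendsto_pi_nhds.2 fun q => tendsto_pi_nhds.2 fun p => ?_
  have h1 := tendsto_pi_nhds.1 ((h p).sub h0) q
  refine (h1.congr fun k => ?_).trans (by simp)
  rw [← transition_mulVec_eq_errorVec_sub N φ μ ν Q y ε θ hy, Matrix.mulVec_single_one]
  rfl

theorem tendsto_errorVec_of_tendsto_transition {μ ν : ℝ} (hμ : 0 ≤ μ) (hν : 0 ≤ ν)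
    (hμν : μ * (1 + 4 * ν) < 1) (Q : ℕ) (y ε : ℕ → Fin n → ℝ)
    (T₀ : Fin n → EuclideanSpace ℝ (Fin m)) (θ : EuclideanSpace ℝ (Fin m))
    (hy : ∀ k i, y (k + 1) i = inner ℝ θ (φ k i) + ε (k + 1) i)
    (hdet : (1 - μ • gMatrix N ν Q φ 0).det ≠ 0) {γ δ : ℝ} (hγ : 0 ≤ γ) (hδ : 0 < δ)
    (hg : ∀ k i j, gain φ k i ≤ γ * gain φ k j)
    (hconv : ∀ i a, ∃ l, Tendsto
      (fun K => ∑ k ∈ Finset.range K, noiseCoeff φ δ k i a * ε (k + 1) i) atTop (𝓝 l))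
    (hΨ : Tendsto (transition N μ ν Q φ 0) atTop (𝓝 0)) :
    Tendsto (errorVec N φ μ ν Q y T₀ θ) atTop (𝓝 0) := by
  -- The factor `r^(-δ)` undoes the weight `r^δ` in `noiseCoeff` and supplies the decay of the
  -- tails.
  have hanti : ∀ i, Antitone fun k => gain φ k i ^ (-δ) := fun i k l hkl =>
    Real.rpow_le_rpow_of_nonpos (gain_pos φ k i) (gain_mono φ i hkl) (by linarith)
  have htail : ∀ q : Fin n × Fin m, ∃ S : ℕ → ℝ,
      (∀ k, S k = gain φ k q.1 ^ (-δ) * (μ * (noiseCoeff φ δ k q.1 q.2 * ε (k + 1) q.1))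
        + S (k + 1)) ∧ Tendsto S atTop (𝓝 0) ∧
      ∃ C, 0 ≤ C ∧ ∀ k, |S k| ≤ C * gain φ k q.1 ^ (-δ) := by
    intro q
    obtain ⟨l, hl⟩ := hconv q.1 q.2
    refine exists_tail_of_antitone_mul (hanti q.1)
      (fun k => Real.rpow_nonneg (gain_pos φ k q.1).le _) (l := μ * l) ?_
    simpa [Finset.mul_sum] using hl.const_mul μ
  choose S hS hSlim C hC hSC using htail
  refine tendsto_zero_of_recursion (H := fun k => μ • gMatrix N ν Q φ k)
    (S := fun k q => S q k) (fun k => (gMatrix_posSemidef N φ hν Q k).smul hμ)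
    (fun k hk => one_sub_smul_gMatrix_posDef N φ hμ hν hμν Q hk) hdet rfl
    (transition_succ N φ μ ν Q) hΨ (errorVec_succ N φ μ ν Q y ε T₀ θ hy) (fun k => ?_)
    (tendsto_pi_nhds.2 hSlim) ?_
  · ext q
    rw [Pi.add_apply, hS q k, Real.rpow_neg (gain_pos φ k q.1).le, noiseCoeff]
    have := (Real.rpow_pos_of_pos (gain_pos φ k q.1) δ).ne'
    field_simp
  · have hbd : Summable fun k => μ * (1 + 4 * ν) * ∑ q : Fin n × Fin m, ∑ j,
        C q ^ 2 * γ ^ (2 * δ) * (‖φ k j‖ ^ 2 / gain φ k j ^ (1 + 2 * δ)) :=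
      (summable_sum fun q _ => summable_sum fun j _ =>
        (summable_norm_sq_div_gain_rpow φ j (by linarith)).mul_left _).mul_left _
    refine Summable.of_nonneg_of_le (fun k => ?_) (fun k => ?_) hbd
    · simpa using ((gMatrix_posSemidef N φ hν Q k).smul hμ).dotProduct_mulVec_nonneg
        fun q => S q k
    · have hx : ∀ j, 0 ≤ ‖φ k j‖ ^ 2 / gain φ k j := fun j =>
        div_nonneg (sq_nonneg _) (gain_pos φ k j).le
      have h1 := dotProduct_gMatrix_mulVec_le N φ hν Q (k := k)
        (Finset.sum_nonneg fun j _ => hx j)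
        (fun i => Finset.single_le_sum (fun j _ => hx j) (Finset.mem_univ i)) fun q => S q k
      have h2 : ∀ q : Fin n × Fin m, ∀ j, ‖φ k j‖ ^ 2 / gain φ k j * (S q k * S q k) ≤
          C q ^ 2 * γ ^ (2 * δ) * (‖φ k j‖ ^ 2 / gain φ k j ^ (1 + 2 * δ)) := by
        intro q j
        have hrq := gain_pos φ k q.1
        have hrj := gain_pos φ k j
        have hSq : S q k * S q k ≤ C q ^ 2 * gain φ k q.1 ^ (-(2 * δ)) := by
          have := pow_le_pow_left₀ (abs_nonneg _) (hSC q k) 2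
          rw [sq_abs, mul_pow, ← Real.rpow_natCast (gain φ k q.1 ^ (-δ)),
            ← Real.rpow_mul hrq.le] at this
          rwa [← sq, show -(2 * δ) = -δ * (2 : ℕ) by push_cast; ring]
        -- The tail decays with the gain of sensor `q.1`, but the ratio belongs to sensor `j`; the
        -- condition number bound links them.
        have hcmp : gain φ k q.1 ^ (-(2 * δ)) ≤ γ ^ (2 * δ) * gain φ k j ^ (-(2 * δ)) := by
          rw [Real.rpow_neg hrq.le, Real.rpow_neg hrj.le, ← div_eq_mul_inv,
            le_div_iff₀ (Real.rpow_pos_of_pos hrj _), inv_mul_le_iff₀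
            (Real.rpow_pos_of_pos hrq _), ← Real.mul_rpow hrq.le hγ, mul_comm _ γ]
          exact Real.rpow_le_rpow hrj.le (hg k j q.1) (by linarith)
        calc _ ≤ ‖φ k j‖ ^ 2 / gain φ k j *
              (C q ^ 2 * (γ ^ (2 * δ) * gain φ k j ^ (-(2 * δ)))) :=
              mul_le_mul_of_nonneg_left
                (hSq.trans (mul_le_mul_of_nonneg_left hcmp (sq_nonneg _))) (hx j)
          _ = _ := by
              rw [Real.rpow_add hrj, Real.rpow_one, Real.rpow_neg hrj.le]
              field_simp
      rw [Matrix.smul_mulVec, dotProduct_smul, smul_eq_mul, mul_assoc μ]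
      refine mul_le_mul_of_nonneg_left (h1.trans ?_) hμ
      rw [mul_assoc]
      refine mul_le_mul_of_nonneg_left ?_ (by linarith)
      rw [dotProduct, Finset.mul_sum]
      refine Finset.sum_le_sum fun q _ => ?_
      rw [Finset.sum_mul]
      exact Finset.sum_le_sum fun j _ => h2 q j

end Path

/-! ### Measurability and almost sure convergence of the weighted noise -/

section Noise

variable {Ω : Type*} {n m : ℕ}
  {φ : ℕ → Fin n → Ω → EuclideanSpace ℝ (Fin m)} {ε : ℕ → Fin n → Ω → ℝ}

theorem measurable_history_regressor {j k : ℕ} (hjk : j ≤ k) (i : Fin n) :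
    Measurable[history φ ε k] (φ j i) := by
  rw [measurable_iff_comap_le]
  refine le_trans ?_ le_sup_left
  exact le_iSup₂_of_le j hjk (le_iSup_of_le i le_rfl)

theorem measurable_history_noise {j k : ℕ} (hj : 1 ≤ j) (hjk : j ≤ k) (i : Fin n) :
    Measurable[history φ ε k] (ε j i) := by
  rw [measurable_iff_comap_le]
  refine le_trans ?_ le_sup_right
  exact le_iSup₂_of_le j ⟨hj, hjk⟩ (le_iSup_of_le i le_rfl)

/-- The observation history as a filtration. -/
def historyFiltration [m0 : MeasurableSpace Ω] (hφ : ∀ k i, Measurable (φ k i))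
    (hε : ∀ k i, Measurable (ε k i)) : Filtration ℕ m0 where
  seq := history φ ε
  mono' := fun _ _ hkl => sup_le_sup
    (biSup_mono fun _ hj => le_trans (Set.mem_Iic.1 hj) hkl)
    (biSup_mono fun _ hj => ⟨hj.1, hj.2.trans hkl⟩)
  le' := fun _ => sup_le
    (iSup₂_le fun j _ => iSup_le fun i => (hφ j i).comap_le)
    (iSup₂_le fun j _ => iSup_le fun i => (hε j i).comap_le)

theorem measurable_noiseCoeff (δ : ℝ) (k : ℕ) (i : Fin n) (a : Fin m) :
    Measurable[history φ ε k] fun ω => noiseCoeff (fun j i => φ j i ω) δ k i a := by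
  have hcoord : Measurable[history φ ε k] fun ω => φ k i ω a :=
    (EuclideanSpace.proj (𝕜 := ℝ) a).continuous.measurable.comp
      (measurable_history_regressor le_rfl i)
  have hnorm : Measurable fun x : EuclideanSpace ℝ (Fin m) => ‖x‖ ^ 2 := by fun_prop
  have hgain : Measurable[history φ ε k] fun ω => gain (fun j i => φ j i ω) k i := by
    refine Measurable.const_add (Finset.measurable_fun_sum _ fun j hj => ?_) 1
    exact hnorm.comp (measurable_history_regressor (Finset.mem_Icc.1 hj).2 i)
  exact (hcoord.div hgain).mul (hgain.pow_const δ)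

theorem ae_tendsto_sum_noiseCoeff_mul [MeasurableSpace Ω] {P : Measure Ω}
    [IsProbabilityMeasure P] (hφ : ∀ k i, Measurable (φ k i)) (hε : ∀ k i, Measurable (ε k i))
    (hint : ∀ k, Integrable (noiseVec ε (k + 1)) P)
    (hmds : ∀ k, P[noiseVec ε (k + 1) | history φ ε k] =ᵐ[P] 0)
    (δ : ℝ) (i : Fin n) (a : Fin m) :
    ∀ᵐ ω ∂P, ∑' k, ‖noiseCoeff (fun j i => φ j i ω) δ k i a‖ₑ ^ 2 *
        (P⁻[fun ω' => ‖noiseVec ε (k + 1) ω'‖ₑ ^ 2 | history φ ε k]) ω ≠ ⊤ →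
      ∃ l, Tendsto (fun K => ∑ k ∈ Finset.range K,
        noiseCoeff (fun j i => φ j i ω) δ k i a * ε (k + 1) i ω) atTop (𝓝 l) := by
  have hproj : ∀ k, (EuclideanSpace.proj (𝕜 := ℝ) i : EuclideanSpace ℝ (Fin n) →L[ℝ] ℝ) ∘
      noiseVec ε (k + 1) = ε (k + 1) i := fun k => rfl
  have hint' : ∀ k, Integrable (ε (k + 1) i) P := fun k =>
    hproj k ▸ (EuclideanSpace.proj (𝕜 := ℝ) i).integrable_comp (hint k)
  have hmds' : ∀ k, P[ε (k + 1) i | history φ ε k] =ᵐ[P] 0 := by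
    intro k
    have h := (EuclideanSpace.proj (𝕜 := ℝ) i : EuclideanSpace ℝ (Fin n) →L[ℝ] ℝ).comp_condExp_comm
      (m := history φ ε k) (hint k)
    rw [hproj k] at h
    filter_upwards [h, hmds k] with ω h1 h2
    rw [← h1, Function.comp_apply, h2]
    simp
  have hmono : ∀ k, P⁻[fun ω' => ‖ε (k + 1) i ω'‖ₑ ^ 2 | history φ ε k] ≤ᵐ[P]
      P⁻[fun ω' => ‖noiseVec ε (k + 1) ω'‖ₑ ^ 2 | history φ ε k] := fun k =>
    condLExp_mono (ae_of_all _ fun ω => pow_le_pow_left' (by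
      rw [enorm_le_iff_norm_le]
      exact PiLp.norm_apply_le (noiseVec ε (k + 1) ω) i) 2)
  filter_upwards [ae_exists_tendsto_sum_mul_of_tsum_condLExp_ne_top (historyFiltration hφ hε)
    (fun k => measurable_history_noise (Nat.le_add_left 1 k) le_rfl i) hint' hmds'
    (fun k => measurable_noiseCoeff δ k i a), ae_all_iff.2 hmono] with ω h1 h2 h3
  exact h1 (ne_top_of_le_ne_top h3 (ENNReal.tsum_le_tsum fun k => mul_le_mul_right (h2 k) _))

end Noise

end DistSG

/-! ### The equivalence -/

theorem mainTheorem1 {Ω : Type*} [MeasurableSpace Ω] (P : Measure Ω) [IsProbabilityMeasure P]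
    {n m : ℕ} (N : DistSG.SensorNetwork n) (hconn : N.graph.Connected)
    (Q : ℕ) (hQ : N.graph.diam ≤ Q)
    (μ ν : ℝ) (hμ : μ ∈ Set.Ioo (0 : ℝ) 1) (hν : ν ∈ Set.Ioo (0 : ℝ) 1)
    (hμν : μ * (1 + 4 * ν) < 1)
    (θ : EuclideanSpace ℝ (Fin m))
    (φ : ℕ → Fin n → Ω → EuclideanSpace ℝ (Fin m)) (hφ : ∀ k i, Measurable (φ k i))
    (ε : ℕ → Fin n → Ω → ℝ) (hε : ∀ k i, Measurable (ε k i))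
    (y : ℕ → Fin n → Ω → ℝ)
    (hy : ∀ k i ω, y (k + 1) i ω = inner ℝ θ (φ k i ω) + ε (k + 1) i ω)
    -- the noise is a martingale difference sequence
    (hint : ∀ k, Integrable (DistSG.noiseVec ε (k + 1)) P)
    (hmds : ∀ k, P[DistSG.noiseVec ε (k + 1) | DistSG.history φ ε k] =ᵐ[P] 0)
    -- `E(‖Ξ_{k+1}‖² | 𝓕_k) ≤ c₀ ‖R_k‖^e`, with `c₀` and `e` possibly depending on the sample
    (hvar : ∀ᵐ ω ∂P, ∃ c₀ > (0 : ℝ), ∃ e ∈ Set.Ico (0 : ℝ) 1, ∀ k,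
      (P⁻[fun ω' => ‖DistSG.noiseVec ε (k + 1) ω'‖ₑ ^ 2 | DistSG.history φ ε k]) ω
        ≤ ENNReal.ofReal (c₀ * ‖DistSG.gainMatrix (fun j i => φ j i ω) k‖ ^ e))
    -- the condition number of `R_k` is bounded, with a bound possibly depending on the sample
    (hcond : ∀ᵐ ω ∂P, ∃ γ > (0 : ℝ), ∀ k,
      (⨆ i, DistSG.gain (fun j i => φ j i ω) k i) / (⨅ i, DistSG.gain (fun j i => φ j i ω) k i)
        ≤ γ)
    -- the first factor is nonsingular (automatic for the later ones, and whenever `‖φ^i_0‖ ≤ 1`)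
    (hG₀ : ∀ᵐ ω ∂P, (1 - μ • DistSG.gMatrix N ν Q (fun j i => φ j i ω) 0).det ≠ 0) :
    (∀ T₀ : Fin n → EuclideanSpace ℝ (Fin m), ∀ᵐ ω ∂P,
        Tendsto (DistSG.estimate N μ ν Q (fun j i => φ j i ω) (fun j i => y j i ω) T₀) atTop
          (𝓝 fun _ => θ)) ↔
      ∀ᵐ ω ∂P,
        Tendsto (DistSG.transition N μ ν Q (fun j i => φ j i ω) 0) atTop (𝓝 0) := by
  constructor
  · intro h
    filter_upwards [h 0, ae_all_iff.2 fun p : Fin n × Fin m => h fun i =>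
      WithLp.toLp 2 fun a => (Pi.single p 1 : Fin n × Fin m → ℝ) (i, a)] with ω h0 hp
    exact DistSG.tendsto_transition_of_tendsto_errorVec N _ μ ν Q _ (fun j i => ε j i ω) θ
      (fun k i => hy k i ω) ((DistSG.tendsto_estimate_iff N _ μ ν Q _ _ θ).1 h0)
      fun p => (DistSG.tendsto_estimate_iff N _ μ ν Q _ _ θ).1 (hp p)
  · intro h T₀
    -- The exponent `e`, hence `δ`, depends on the sample, so the null sets are first collected over
    -- the countable family `δ = 1 / (p + 1)`.
    have hconv := ae_all_iff.2 fun p : ℕ => ae_all_iff.2 fun i : Fin n => ae_all_iff.2 fun a =>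
      DistSG.ae_tendsto_sum_noiseCoeff_mul hφ hε hint hmds (1 / ((p : ℝ) + 1)) i a
    filter_upwards [h, hvar, hcond, hG₀, hconv] with ω hΨ hv hγ hdet hc
    obtain ⟨c₀, hc₀, e, he, hV⟩ := hv
    obtain ⟨γ, hγ0, hγ⟩ := hγ
    have hg := fun k => DistSG.gain_le_mul_gain _ (hγ k)
    obtain ⟨p, hp⟩ := exists_nat_one_div_lt (show 0 < (1 - e) / 2 by linarith [he.2])
    refine (DistSG.tendsto_estimate_iff N _ μ ν Q _ _ θ).2 ?_
    exact DistSG.tendsto_errorVec_of_tendsto_transition N _ hμ.1.le hν.1.le hμν Q _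
      (fun j i => ε j i ω) T₀ θ (fun k i => hy k i ω) hdet hγ0.le Nat.one_div_pos_of_nat hg
      (fun i a => hc p i a (DistSG.tsum_noiseCoeff_sq_mul_ne_top _ hc₀.le he.1 (by linarith)
        hγ0.le hg hV i a)) hΨ
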